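/- **Theorem (discrete-time multi-agent systems).** Let $\mathcal X\subseteq\mathbb R^n$ be open and convex, let $\mathcal G=(\mathcal V,\mathcal E)$ be a directed graph on $\mathcal V=\{1,\dots,n\}$, and let $f=(f_1,\dots,f_n):\mathcal X\to\mathcal X$ have components of class $C^1$, where each local rule $f_i$ depends only on $x_i$ and on the $x_j$ with $(i,j)\in\mathcal E$. Consider the system $x(k+1)=f(x(k))$, $k\in\mathbb N$, and suppose that 1. $\partial f_i/\partial x_i>0$ everywhere on $\mathcal X$ and, for $j\ne i$, $\partial f_i/\partial x_j\ge 0$ almost everywhere on $\mathcal X$; 2. for all $x\in\mathcal X$ and $\alpha\in\mathbb R$ one has $x+\alpha\mathbf 1\in\mathcal X$ and $f_i(x+\alpha\mathbf 1)=f_i(x)+\alpha$ for every $i$. (a) If $f$ has an equilibrium point (a point $x_e\in\mathcal X$ with $f(x_e)=x_e$), then for every $x(0)\in\mathcal X$ whose trajectory $\{x(k):k\in\mathbb N\}$ has its closure contained in $\mathcal X$ (a void condition when $\mathcal X=\mathbb R^n$) the trajectory converges to an equilibrium point in $\mathcal X$. (b) Say that agent $i$ *is influenced by* agent $j$ (at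 consensus) if changing the state of agent $j$ alone away from a consensus state changes the next state of agent $i$, that is, $f_i(c\mathbf 1+t e_j)\neq f_i(c\mathbf 1)$ for all $c\in\mathbb R$ and $t\ne0$ with $c\mathbf 1,\ c\mathbf 1+te_j\in\mathcal X$. (Under 1 this holds in particular if $\partial f_i/\partial x_j>0$ at the consensus states in $\mathcal X$.) Suppose, in addition to 1 and 2, that 3. $\mathbf 0\in\mathcal X$ and $f_i(\mathbf 0)=0$ for every $i$; 4. the graph of the edges $(i,j)\in\mathcal E$ such that agent $i$ is influenced by agent $j$ (the whole graph $\mathcal G$, if all its edges are of this kind) has a globally reachable node $r$: from every node $j$ there is a directed path $j=v_0,v_1,\dots,v_m=r$ along its edges $(v_k,v_{k+1})$, with $m\ge 0$. Then for every $x(0)\in\mathcal X$, with no condition on the closure of the trajectory, there is $c\in\mathbb R$ with $\lim_{k\to\infty}x(k)=c\mathbf 1$. -/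

import Mathlib

open Set Filter Topology MeasureTheory

/-- The consensus vector `c • 𝟏`. -/
def consensusVec {n : ℕ} (c : ℝ) : Fin n → ℝ := fun _ => c

/-- The map `x ↦ (f₁ x, …, fₙ x)` on states whose components are the local interaction rules. -/
def masMap {n : ℕ} (f : Fin n → (Fin n → ℝ) → ℝ) (x : Fin n → ℝ) : Fin n → ℝ := fun i => f i x

/-- The state at time `k` of `x (k + 1) = f (x k)` started at `x 0 = ξ`. -/
def trajectory {n : ℕ} (f : Fin n → (Fin n → ℝ) → ℝ) (ξ : Fin n → ℝ) (k : ℕ) : Fin n → ℝ :=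
  (masMap f)^[k] ξ

/-- The set of equilibrium points in the state space `X`. -/
def equilibria {n : ℕ} (X : Set (Fin n → ℝ)) (f : Fin n → (Fin n → ℝ) → ℝ) :
    Set (Fin n → ℝ) :=
  {x | x ∈ X ∧ masMap f x = x}

/-- The partial derivative `∂ fᵢ / ∂ xⱼ` at `x`. -/
noncomputable def partialD {n : ℕ} (f : Fin n → (Fin n → ℝ) → ℝ) (i j : Fin n)
    (x : Fin n → ℝ) : ℝ :=
  fderiv ℝ (f i) x (Pi.single j 1)

/-- The rules are local with respect to the graph `G`: on `X`, the rule of agent `i` depends only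
on the state of `i` and on the states of its neighbours, the `j` with an edge `(i, j)`. -/
def IsLocalRule {n : ℕ} (G : Digraph (Fin n)) (X : Set (Fin n → ℝ))
    (f : Fin n → (Fin n → ℝ) → ℝ) : Prop :=
  ∀ i, ∀ x ∈ X, ∀ y ∈ X, x i = y i → (∀ j, G.Adj i j → x j = y j) → f i x = f i y

/-- Agent `i` is influenced by agent `j` at consensus: starting from a consensus state, any change
of the state of agent `j` alone changes the next state of agent `i`. (For a rule that is
nondecreasing in each variable, `∂ fᵢ / ∂ xⱼ > 0` at the consensus states is sufficient.) -/
def InfluencedBy {n : ℕ} (X : Set (Fin n → ℝ)) (f : Fin n → (Fin n → ℝ) → ℝ)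
    (i j : Fin n) : Prop :=
  ∀ c t : ℝ, t ≠ 0 → consensusVec c ∈ X → consensusVec c + Pi.single j t ∈ X →
    f i (consensusVec c + Pi.single j t) ≠ f i (consensusVec c)

/-- The subgraph of `G` of the edges `(i, j)` along which agent `i` is influenced by agent `j`
at consensus. -/
def influenceGraph {n : ℕ} (G : Digraph (Fin n)) (X : Set (Fin n → ℝ))
    (f : Fin n → (Fin n → ℝ) → ℝ) : Digraph (Fin n) where
  Adj i j := G.Adj i j ∧ InfluencedBy X f i j

/-- `r` is globally reachable: from every node a directed path leads to `r`. -/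
def IsGloballyReachable {n : ℕ} (G : Digraph (Fin n)) (r : Fin n) : Prop :=
  ∀ j, Relation.ReflTransGen G.Adj j r

/-!
The sign conditions on the partial derivatives make every rule `f i` monotone on the convex set `X`,
strictly so in its own variable (`rule_mono`, `rule_strictMono_self`). Together with
`f i (x + α 𝟏) = f i x + α` this gives the one-sided bound
`x ≤ y + c 𝟏 → f x ≤ f y + c 𝟏`, hence the system is nonexpansive for the sup norm and it extends to
a 1-Lipschitz map `g` of the whole space, which satisfies the same one-sided bound on `closure X`
(`exists_extension`).

Since there is an equilibrium, the trajectory is bounded and has a limit point `y`. A continuous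
function `V` that does not increase along the trajectory is constant along the orbit of `y`
(`lyapunov_const_on_limit_orbit`). For the convergence to an equilibrium this is used for the
largest coordinates of `g x - x` and of `x - g x`, for the convergence to a consensus state for those
of `x` and of `-x`.

Let `u k` be the increment (respectively the state) at time `k` on the orbit of `y`, and `M` the
constant value of its largest coordinate. Strictness in the own variable shows that an agent where
`u (k + 1)` equals `M` was already at `M` at time `k`, so the sets of maximising agents decrease with
`k` and some agent is in all of them (`exists_forall_eq_max`). For the increments, that agent moves
by `M` at every step, and boundedness forces `M = 0`; likewise for the smallest increment, so `y` is
an equilibrium (`limit_point_isFixed`). For the states, the agents that stay at `M` forever are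
closed under influence, so the globally reachable agent is one of them
(`forall_eq_max_of_reachable`); it also stays at the minimum forever, so `y` is a consensus state
(`limit_point_isConsensus`). Here the limit point may lie on the boundary of `X`, where the rules
need not be strictly monotone, but it suffices to compare it, by means of the one-sided bound, with
perturbed consensus states, which lie in `X`.

In both cases `y` is a fixed point of `g`, and as `g` is nonexpansive the whole trajectory converges
to `y`.
-/

/-! ### Limit points of the orbits of a nonexpansive map -/

/-- Invariance principle: a function decreasing along an orbit is constant along the orbit of each
of its limit points. -/
theorem lyapunov_const_on_limit_orbit {E : Type*} [TopologicalSpace E] {g : E → E}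
    (hg : Continuous g) {ξ y : E} {φ : ℕ → ℕ} (hφ : StrictMono φ)
    (hy : Tendsto (fun k => g^[φ k] ξ) atTop (𝓝 y)) {V : E → ℝ} (hV : Continuous V)
    (hanti : Antitone fun k => V (g^[k] ξ)) (m : ℕ) : V (g^[m] y) = V y := by
  have h0 : Tendsto (fun k => V (g^[k] ξ)) atTop (𝓝 (V y)) :=
    (tendsto_iff_tendsto_subseq_of_antitone hanti hφ.tendsto_atTop).2
      ((hV.tendsto y).comp hy)
  have h1 : Tendsto (fun k => V (g^[φ k + m] ξ)) atTop (𝓝 (V (g^[m] y))) := by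
    simp only [add_comm _ m, Function.iterate_add_apply]
    exact ((hV.comp (hg.iterate m)).tendsto y).comp hy
  have h2 : Tendsto (fun k => φ k + m) atTop atTop :=
    (tendsto_add_atTop_nat m).comp hφ.tendsto_atTop
  exact tendsto_nhds_unique h1 (h0.comp h2)

theorem dist_iterate_antitone {E : Type*} [PseudoMetricSpace E] {g : E → E}
    (hg : LipschitzWith 1 g) {p : E} (hp : g p = p) (ξ : E) :
    Antitone fun k => dist (g^[k] ξ) p := by
  refine antitone_nat_of_succ_le fun k => ?_
  rw [Function.iterate_succ_apply']
  simpa [hp] using hg.dist_le_mul (g^[k] ξ) p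

theorem tendsto_iterate_of_subseq {E : Type*} [PseudoMetricSpace E] {g : E → E}
    (hg : LipschitzWith 1 g) {ξ y : E} {φ : ℕ → ℕ} (hφ : StrictMono φ)
    (hy : Tendsto (fun k => g^[φ k] ξ) atTop (𝓝 y)) (hfix : g y = y) :
    Tendsto (fun k => g^[k] ξ) atTop (𝓝 y) := by
  rw [tendsto_iff_dist_tendsto_zero] at hy ⊢
  exact (tendsto_iff_tendsto_subseq_of_antitone (dist_iterate_antitone hg hfix ξ)
    hφ.tendsto_atTop).2 hy

theorem exists_limit_point {n : ℕ} {g : (Fin n → ℝ) → Fin n → ℝ} (hg : LipschitzWith 1 g)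
    {p : Fin n → ℝ} (hp : g p = p) (ξ : Fin n → ℝ) :
    ∃ y, ∃ φ : ℕ → ℕ, StrictMono φ ∧ Tendsto (fun k => g^[φ k] ξ) atTop (𝓝 y) := by
  obtain ⟨y, -, φ, hφ, hy⟩ := tendsto_subseq_of_bounded (x := fun k => g^[k] ξ)
    (Metric.isBounded_closedBall (x := p) (r := dist ξ p))
    (fun k => by simpa using dist_iterate_antitone hg hp ξ (Nat.zero_le k))
  exact ⟨y, φ, hφ, hy⟩

/-! ### The largest coordinate along an orbit -/

/-- The largest coordinate of a vector. -/
noncomputable def maxCoord {n : ℕ} [Nonempty (Fin n)] (x : Fin n → ℝ) : ℝ :=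
  Finset.univ.sup' Finset.univ_nonempty x

section maxCoord

variable {n : ℕ} [Nonempty (Fin n)]

theorem le_maxCoord (x : Fin n → ℝ) (i : Fin n) : x i ≤ maxCoord x :=
  Finset.le_sup' x (Finset.mem_univ i)

theorem maxCoord_le {x : Fin n → ℝ} {M : ℝ} (h : ∀ i, x i ≤ M) : maxCoord x ≤ M :=
  Finset.sup'_le _ _ fun i _ => h i

theorem exists_eq_maxCoord (x : Fin n → ℝ) : ∃ i, x i = maxCoord x := by
  obtain ⟨i, -, hi⟩ := Finset.exists_mem_eq_sup' Finset.univ_nonempty x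
  exact ⟨i, hi.symm⟩

theorem continuous_maxCoord : Continuous (maxCoord (n := n)) :=
  Continuous.finset_sup'_apply _ fun i _ => continuous_apply i

end maxCoord

/-- The sets of agents that attain the value `M` at time `k` are nonempty and decrease with `k`, so
they have a common element. -/
theorem exists_forall_eq_max {n : ℕ} {u : ℕ → Fin n → ℝ} {M : ℝ} (hex : ∀ k, ∃ i, u k i = M)
    (hback : ∀ k i, u (k + 1) i = M → u k i = M) : ∃ i, ∀ k, u k i = M := by
  by_contra! h
  choose K hK using h
  have hdown : ∀ i k l, k ≤ l → u l i = M → u k i = M := fun i k l hkl hl => by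
    induction l, hkl using Nat.le_induction with
    | base => exact hl
    | succ l _ ih => exact ih (hback l i hl)
  obtain ⟨i, hi⟩ := hex (Finset.univ.sup K)
  exact hK i (hdown i _ _ (Finset.le_sup (Finset.mem_univ i)) hi)

/-- If attaining `M` at time `k + 1` forces the agents related to it to attain `M` at time `k`,
then an agent reachable from all the others attains `M` at all times. -/
theorem forall_eq_max_of_reachable {n : ℕ} {u : ℕ → Fin n → ℝ} {M : ℝ} {E : Fin n → Fin n → Prop}
    {r : Fin n} (hr : ∀ j, Relation.ReflTransGen E j r) (hex : ∀ k, ∃ i, u k i = M)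
    (hback : ∀ k i, u (k + 1) i = M → ∀ j, j = i ∨ E i j → u k j = M) : ∀ k, u k r = M := by
  obtain ⟨i, hi⟩ := exists_forall_eq_max hex fun k i h => hback k i h i (Or.inl rfl)
  have hclosed : ∀ j, Relation.ReflTransGen E i j → ∀ k, u k j = M := fun j hj => by
    induction hj with
    | refl => exact hi
    | tail _ hjl ih => exact fun k => hback k _ (ih (k + 1)) _ (Or.inr hjl)
  exact hclosed r (hr i)

/-- If the largest coordinate of `W` does not increase along the orbits in `S`, it is constant and
attained along the orbit of a limit point. -/
theorem exists_max_const_on_limit_orbit {n : ℕ} [Nonempty (Fin n)] {S : Set (Fin n → ℝ)}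
    {g W : (Fin n → ℝ) → Fin n → ℝ} (hg : Continuous g) (hgS : MapsTo g S S) (hW : Continuous W)
    (hdecr : ∀ x ∈ S, ∀ M, (∀ j, W x j ≤ M) → ∀ j, W (g x) j ≤ M)
    {ξ y : Fin n → ℝ} (hξ : ξ ∈ S) {φ : ℕ → ℕ} (hφ : StrictMono φ)
    (hy : Tendsto (fun k => g^[φ k] ξ) atTop (𝓝 y)) :
    ∃ M, (∀ k j, W (g^[k] y) j ≤ M) ∧ ∀ k, ∃ i, W (g^[k] y) i = M := by
  have hconst := lyapunov_const_on_limit_orbit hg hφ hy (continuous_maxCoord.comp hW)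
    (antitone_nat_of_succ_le fun k => by
      rw [Function.iterate_succ_apply']
      exact maxCoord_le (hdecr _ (hgS.iterate k hξ) _ (le_maxCoord _)))
  refine ⟨maxCoord (W y), fun k j => ?_, fun k => ?_⟩
  · exact (le_maxCoord _ j).trans_eq (hconst k)
  · obtain ⟨i, hi⟩ := exists_eq_maxCoord (W (g^[k] y))
    exact ⟨i, hi.trans (hconst k)⟩

/-- A bounded real sequence does not have a constant nonzero increment. -/
theorem increment_eq_zero_of_bounded {a : ℕ → ℝ} {M C : ℝ} (ha : ∀ k, a (k + 1) - a k = M)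
    (hC : ∀ k, |a k| ≤ C) : M = 0 := by
  have hlin : ∀ k : ℕ, a k = a 0 + k * M := fun k => by
    induction k with
    | zero => simp
    | succ k ih => push_cast; linarith [ha k]
  by_contra hM
  obtain ⟨k, hk⟩ := exists_nat_gt (2 * C / |M|)
  rw [div_lt_iff₀ (abs_pos.2 hM), ← Nat.abs_cast k, ← abs_mul] at hk
  have h1 : (k : ℝ) * M = a k - a 0 := by linarith [hlin k]
  rw [h1] at hk
  linarith [abs_sub (a k) (a 0), hC k, hC 0]

/-! ### Monotonicity of the rules and the nonexpansive extension -/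

section system

variable {n : ℕ} {X : Set (Fin n → ℝ)} {f : Fin n → (Fin n → ℝ) → ℝ}

/-- A partial derivative that is nonnegative almost everywhere is nonnegative everywhere, being
continuous. -/
theorem partialD_nonneg (hXopen : IsOpen X) {i j : Fin n} (hC1 : ContDiffOn ℝ 1 (f i) X)
    (hoff : ∀ᵐ x ∂(volume.restrict X), 0 ≤ partialD f i j x) :
    ∀ x ∈ X, 0 ≤ partialD f i j x := by
  have hcont : ContinuousOn (partialD f i j) X :=
    (hC1.continuousOn_fderiv_of_isOpen hXopen le_rfl).clm_apply continuousOn_const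
  have hopen : IsOpen (X ∩ partialD f i j ⁻¹' Iio 0) :=
    hcont.isOpen_inter_preimage hXopen isOpen_Iio
  have hnull : volume (X ∩ partialD f i j ⁻¹' Iio 0) = 0 := by
    rw [ae_restrict_iff' hXopen.measurableSet, ae_iff] at hoff
    convert hoff using 2
    ext x
    simp
  intro x hx
  by_contra! hneg
  exact ((hopen.measure_eq_zero_iff volume).1 hnull).subset ⟨hx, hneg⟩

theorem fderiv_eq_sum_partialD (i : Fin n) (z v : Fin n → ℝ) :
    fderiv ℝ (f i) z v = ∑ j, v j * partialD f i j z := by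
  conv_lhs => rw [pi_eq_sum_univ' v]
  simp [partialD, map_sum]

/-- Mean value theorem in terms of partial derivatives. -/
theorem exists_sub_eq_sum_partialD (hXopen : IsOpen X) (hXconv : Convex ℝ X) {i : Fin n}
    (hC1 : ContDiffOn ℝ 1 (f i) X) {x y : Fin n → ℝ} (hx : x ∈ X) (hy : y ∈ X) :
    ∃ z ∈ X, f i y - f i x = ∑ j, (y j - x j) * partialD f i j z := by
  obtain ⟨z, hz, h⟩ := domain_mvt (f' := fun z => fderiv ℝ (f i) z)
    (fun z hz => (((hC1.differentiableOn one_ne_zero).differentiableAt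
      (hXopen.mem_nhds hz)).hasFDerivAt).hasFDerivWithinAt) hXconv hx hy
  exact ⟨z, hXconv.segment_subset hx hy hz, by rw [h, fderiv_eq_sum_partialD]; rfl⟩

theorem rule_mono (hXopen : IsOpen X) (hXconv : Convex ℝ X) {i : Fin n}
    (hC1 : ContDiffOn ℝ 1 (f i) X) (hnn : ∀ j, ∀ x ∈ X, 0 ≤ partialD f i j x)
    {x y : Fin n → ℝ} (hx : x ∈ X) (hy : y ∈ X) (hxy : x ≤ y) : f i x ≤ f i y := by
  obtain ⟨z, hz, h⟩ := exists_sub_eq_sum_partialD hXopen hXconv hC1 hx hy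
  have := Finset.sum_nonneg fun j (_ : j ∈ Finset.univ) =>
    mul_nonneg (sub_nonneg.2 (hxy j)) (hnn j z hz)
  linarith

theorem rule_strictMono_self (hXopen : IsOpen X) (hXconv : Convex ℝ X) {i : Fin n}
    (hC1 : ContDiffOn ℝ 1 (f i) X) (hnn : ∀ j, ∀ x ∈ X, 0 ≤ partialD f i j x)
    (hdiag : ∀ x ∈ X, 0 < partialD f i i x)
    {x y : Fin n → ℝ} (hx : x ∈ X) (hy : y ∈ X) (hxy : x ≤ y) (hi : x i < y i) :
    f i x < f i y := by
  obtain ⟨z, hz, h⟩ := exists_sub_eq_sum_partialD hXopen hXconv hC1 hx hy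
  have := Finset.sum_pos' (fun j (_ : j ∈ Finset.univ) =>
    mul_nonneg (sub_nonneg.2 (hxy j)) (hnn j z hz))
    ⟨i, Finset.mem_univ i, mul_pos (sub_pos.2 hi) (hdiag z hz)⟩
  linarith

/-- A monotone map that commutes with the translations along `𝟏` extends to a nonexpansive map `g`
of the whole space that satisfies the one-sided bound `x ≤ y + c 𝟏 → g x ≤ g y + c 𝟏` on the
closure of its domain. -/
theorem exists_extension
    (hmono : ∀ i, ∀ x ∈ X, ∀ y ∈ X, x ≤ y → f i x ≤ f i y)
    (hplus : ∀ x ∈ X, ∀ α : ℝ, x + consensusVec α ∈ X ∧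
      ∀ i, f i (x + consensusVec α) = f i x + α) :
    ∃ g : (Fin n → ℝ) → Fin n → ℝ, LipschitzWith 1 g ∧ EqOn (masMap f) g X ∧
      ∀ x ∈ closure X, ∀ y ∈ closure X, ∀ c : ℝ, (∀ j, x j ≤ y j + c) →
        ∀ i, g x i ≤ g y i + c := by
  have hbound : ∀ x ∈ X, ∀ y ∈ X, ∀ c : ℝ, (∀ j, x j ≤ y j + c) → ∀ i, f i x ≤ f i y + c :=
    fun x hx y hy c h i => by
      rw [← (hplus y hy c).2 i]
      exact hmono i x hx _ (hplus y hy c).1 h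
  have hlip : LipschitzOnWith 1 (masMap f) X := by
    refine LipschitzOnWith.of_dist_le_mul fun x hx y hy => ?_
    rw [NNReal.coe_one, one_mul, dist_pi_le_iff dist_nonneg]
    have hle : ∀ x y : Fin n → ℝ, ∀ j, x j ≤ y j + dist x y := fun x y j => by
      linarith [(le_abs_self _).trans (dist_le_pi_dist x y j)]
    intro i
    rw [Real.dist_eq, abs_sub_le_iff]
    constructor
    · linarith [hbound x hx y hy _ (hle x y) i, show masMap f x i = f i x from rfl,
        show masMap f y i = f i y from rfl]
    · linarith [hbound y hy x hx _ (hle y x) i, show masMap f x i = f i x from rfl,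
        show masMap f y i = f i y from rfl, dist_comm x y]
  obtain ⟨g, hg, hfg⟩ := hlip.extend_pi
  refine ⟨g, hg, hfg, fun x hx y hy c h i => le_of_forall_pos_le_add fun ε hε => ?_⟩
  -- Replace `x` and `y` by points of `X` at distance less than `ε / 4`.
  obtain ⟨x', hx', hxx⟩ := Metric.mem_closure_iff.1 hx (ε / 4) (by positivity)
  obtain ⟨y', hy', hyy⟩ := Metric.mem_closure_iff.1 hy (ε / 4) (by positivity)
  have hb := hbound x' hx' y' hy' (c + ε / 2) (fun j => by
    have h1 := abs_lt.1 ((dist_le_pi_dist x x' j).trans_lt hxx)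
    have h2 := abs_lt.1 ((dist_le_pi_dist y y' j).trans_lt hyy)
    linarith [h j, h1.1, h1.2, h2.1, h2.2]) i
  have e1 : f i x' = g x' i := congrFun (hfg hx') i
  have e2 : f i y' = g y' i := congrFun (hfg hy') i
  have hgx := abs_lt.1 ((dist_le_pi_dist (g x) (g x') i).trans_lt
    (((hg.dist_le_mul x x').trans_eq (by simp)).trans_lt hxx))
  have hgy := abs_lt.1 ((dist_le_pi_dist (g y) (g y') i).trans_lt
    (((hg.dist_le_mul y y').trans_eq (by simp)).trans_lt hyy))
  linarith [hgx.1, hgx.2, hgy.1, hgy.2]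

theorem trajectory_eq_iterate (hmaps : MapsTo (masMap f) X X) {g : (Fin n → ℝ) → Fin n → ℝ}
    (hfg : EqOn (masMap f) g X) {ξ : Fin n → ℝ} (hξ : ξ ∈ X) (k : ℕ) :
    trajectory f ξ k = g^[k] ξ := by
  induction k with
  | zero => rfl
  | succ k ih =>
    have hk : trajectory f ξ k ∈ X := hmaps.iterate k hξ
    rw [Function.iterate_succ_apply', ← ih, ← hfg hk]
    exact Function.iterate_succ_apply' _ _ _

/-! ### Limit points are equilibria -/

/-- A limit point in `X` of an orbit is a fixed point: the extreme coordinates of the increment are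
constant along its orbit, each is attained by one agent at all times, and the orbit is bounded. -/
theorem limit_point_isFixed [Nonempty (Fin n)] {g : (Fin n → ℝ) → Fin n → ℝ}
    (hg : LipschitzWith 1 g) (hgX : MapsTo g X X)
    (hbound : ∀ x ∈ X, ∀ y ∈ X, ∀ c : ℝ, (∀ j, x j ≤ y j + c) → ∀ i, g x i ≤ g y i + c)
    (hstrict : ∀ x ∈ X, ∀ y ∈ X, ∀ c : ℝ, (∀ j, x j ≤ y j + c) → ∀ i, x i < y i + c →
      g x i < g y i + c)
    {p ξ y : Fin n → ℝ} (hp : g p = p) (hξ : ξ ∈ X) (hyX : y ∈ X) {φ : ℕ → ℕ} (hφ : StrictMono φ)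
    (hy : Tendsto (fun k => g^[φ k] ξ) atTop (𝓝 y)) : g y = y := by
  have horb : ∀ k, g^[k] y ∈ X := fun k => hgX.iterate k hyX
  have hbdd : ∀ i k, |g^[k] y i| ≤ dist y p + |p i| := fun i k => by
    have h1 := (dist_le_pi_dist (g^[k] y) p i).trans (dist_iterate_antitone hg hp y k.zero_le)
    rw [Real.dist_eq] at h1
    have h2 := abs_add_le (g^[k] y i - p i) (p i)
    rw [sub_add_cancel] at h2
    exact h2.trans (add_le_add_left h1 _)
  obtain ⟨M, hMle, hMex⟩ := exists_max_const_on_limit_orbit (W := fun x => g x - x) hg.continuous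
    hgX (hg.continuous.sub continuous_id) (fun x hx M h j => by
      have := hbound (g x) (hgX hx) x hx M (fun j => by linarith [h j, Pi.sub_apply (g x) x j]) j
      linarith [Pi.sub_apply (g (g x)) (g x) j]) hξ hφ hy
  obtain ⟨m, hmle, hmex⟩ := exists_max_const_on_limit_orbit (W := fun x => x - g x) hg.continuous
    hgX (continuous_id.sub hg.continuous) (fun x hx M h j => by
      have := hbound x hx (g x) (hgX hx) M (fun j => by linarith [h j, Pi.sub_apply x (g x) j]) j
      linarith [Pi.sub_apply (g x) (g (g x)) j]) hξ hφ hy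
  simp only [Pi.sub_apply] at hMle hMex hmle hmex
  obtain ⟨i, hi⟩ := exists_forall_eq_max (u := fun k => g (g^[k] y) - g^[k] y) hMex
    fun k i h => by
      simp only [Function.iterate_succ_apply', Pi.sub_apply] at h ⊢
      refine le_antisymm (hMle k i) ?_
      by_contra! hlt
      have := hstrict _ (hgX (horb k)) _ (horb k) M (fun j => by linarith [hMle k j]) i
        (by linarith)
      linarith
  obtain ⟨l, hl⟩ := exists_forall_eq_max (u := fun k => g^[k] y - g (g^[k] y)) hmex
    fun k i h => by
      simp only [Function.iterate_succ_apply', Pi.sub_apply] at h ⊢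
      refine le_antisymm (hmle k i) ?_
      by_contra! hlt
      have := hstrict _ (horb k) _ (hgX (horb k)) m (fun j => by linarith [hmle k j]) i
        (by linarith)
      linarith
  simp only [Pi.sub_apply] at hi hl
  have hM : M = 0 := increment_eq_zero_of_bounded
    (fun k => by rw [Function.iterate_succ_apply']; exact hi k) (hbdd i)
  have hm : -m = 0 := increment_eq_zero_of_bounded
    (fun k => by rw [Function.iterate_succ_apply']; linarith [hl k]) (hbdd l)
  funext j
  have h1 : g y j - y j ≤ M := hMle 0 j
  have h2 : y j - g y j ≤ m := hmle 0 j
  linarith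

theorem consensusVec_add_single_apply_self (c t : ℝ) (j : Fin n) :
    (consensusVec c + Pi.single j t : Fin n → ℝ) j = c + t := by
  simp [consensusVec]

theorem consensusVec_add_single_apply_of_ne (c t : ℝ) {i j : Fin n} (h : i ≠ j) :
    (consensusVec c + Pi.single j t : Fin n → ℝ) i = c := by
  simp [consensusVec, h]

theorem influencedBy_self {i : Fin n}
    (hstrict : ∀ x ∈ X, ∀ y ∈ X, x ≤ y → x i < y i → f i x < f i y) : InfluencedBy X f i i := by
  intro c t ht hc hct
  rcases ht.lt_or_gt with h | h
  · exact (hstrict _ hct _ hc (add_le_of_nonpos_right (Pi.single_nonpos.2 h.le))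
      (by rw [consensusVec_add_single_apply_self]; simpa [consensusVec] using h)).ne
  · exact (hstrict _ hc _ hct (le_add_of_nonneg_right (Pi.single_nonneg.2 h.le))
      (by rw [consensusVec_add_single_apply_self]; simpa [consensusVec] using h)).ne'

/-- Perturbations of a consensus state in one coordinate stay in the open set `X` if they are
small. -/
theorem exists_perturbation_mem (hXopen : IsOpen X) {c : ℝ} (hc : consensusVec c ∈ X)
    (j : Fin n) {η : ℝ} (hη : 0 < η) :
    ∃ t, 0 < t ∧ t ≤ η ∧ consensusVec c + Pi.single j t ∈ X ∧
      consensusVec c + Pi.single j (-t) ∈ X := by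
  obtain ⟨ε, hε, hball⟩ := Metric.isOpen_iff.1 hXopen _ hc
  have hmem : ∀ s : ℝ, |s| < ε → consensusVec c + Pi.single j s ∈ X := fun s hs =>
    hball (by simpa [dist_eq_norm, Pi.norm_single] using hs)
  have ht : 0 < min η (ε / 2) := lt_min hη (half_pos hε)
  have hlt : |min η (ε / 2)| < ε := by
    rw [abs_of_pos ht]
    exact (min_le_right _ _).trans_lt (half_lt_self hε)
  exact ⟨_, ht, min_le_left _ _, hmem _ hlt, hmem _ (by rwa [abs_neg])⟩

/-- Under influence through a globally reachable agent, a limit point, possibly on the boundary of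
`X`, is a consensus state. -/
theorem limit_point_isConsensus [Nonempty (Fin n)] (hXopen : IsOpen X)
    {g : (Fin n → ℝ) → Fin n → ℝ} (hg : LipschitzWith 1 g) (hfg : EqOn (masMap f) g X)
    (hgX : MapsTo g (closure X) (closure X))
    (hbound : ∀ x ∈ closure X, ∀ y ∈ closure X, ∀ c : ℝ, (∀ j, x j ≤ y j + c) →
      ∀ i, g x i ≤ g y i + c)
    (hcons : ∀ c : ℝ, consensusVec c ∈ X) (hfix : ∀ c : ℝ, ∀ i, f i (consensusVec c) = c)
    (hself : ∀ i, InfluencedBy X f i i) {r : Fin n}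
    (hr : ∀ j, Relation.ReflTransGen (InfluencedBy X f) j r)
    {ξ y : Fin n → ℝ} (hξ : ξ ∈ closure X) (hyX : y ∈ closure X) {φ : ℕ → ℕ} (hφ : StrictMono φ)
    (hy : Tendsto (fun k => g^[φ k] ξ) atTop (𝓝 y)) : ∃ c, y = consensusVec c := by
  have hgcons : ∀ c i, g (consensusVec c) i = c := fun c i =>
    (congrFun (hfg (hcons c)) i).symm.trans (hfix c i)
  have hmono : ∀ x ∈ closure X, ∀ y ∈ closure X, x ≤ y → ∀ i, g x i ≤ g y i :=
    fun x hx y hy h i => by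
      simpa using hbound x hx y hy 0 (fun j => by simpa using h j) i
  have horb : ∀ k, g^[k] y ∈ closure X := fun k => hgX.iterate k hyX
  have hne : ∀ i j, InfluencedBy X f i j → ∀ c t : ℝ, t ≠ 0 →
      consensusVec c + Pi.single j t ∈ X → g (consensusVec c + Pi.single j t) i ≠ c :=
    fun i j hij c t ht hct h => by
      have hfz : f i (consensusVec c + Pi.single j t) = g (consensusVec c + Pi.single j t) i :=
        congrFun (hfg hct) i
      exact hij c t ht (hcons c) hct (by rw [hfz, h, hfix])
  -- Agent `i` moves to an upper bound `M` of all states only if the agents that influence it were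
  -- already there: otherwise the state lies below a perturbation of `M 𝟏` inside `X`.
  have hup : ∀ M, ∀ x ∈ closure X, (∀ j, x j ≤ M) → ∀ i, g x i = M →
      ∀ j, InfluencedBy X f i j → x j = M := fun M x hx hle i hi j hij => by
    by_contra hlt
    obtain ⟨t, ht, htle, -, hmem⟩ := exists_perturbation_mem hXopen (hcons M) j
      (sub_pos.2 (lt_of_le_of_ne (hle j) hlt))
    refine hne i j hij M (-t) (neg_ne_zero.2 ht.ne') hmem (le_antisymm ?_ ?_)
    · exact (hmono _ (subset_closure hmem) _ (subset_closure (hcons M))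
        (add_le_of_nonpos_right (Pi.single_nonpos.2 (by linarith))) i).trans_eq (hgcons M i)
    · refine hi.symm.trans_le (hmono x hx _ (subset_closure hmem) (fun l => ?_) i)
      rcases eq_or_ne l j with rfl | hlj
      · rw [consensusVec_add_single_apply_self]
        linarith
      · rw [consensusVec_add_single_apply_of_ne _ _ hlj]
        exact hle l
  have hdown : ∀ m, ∀ x ∈ closure X, (∀ j, m ≤ x j) → ∀ i, g x i = m →
      ∀ j, InfluencedBy X f i j → x j = m := fun m x hx hle i hi j hij => by
    by_contra hlt
    obtain ⟨t, ht, htle, hmem, -⟩ := exists_perturbation_mem hXopen (hcons m) j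
      (sub_pos.2 (lt_of_le_of_ne (hle j) (Ne.symm hlt)))
    refine hne i j hij m t ht.ne' hmem (le_antisymm ?_ ?_)
    · refine (hmono _ (subset_closure hmem) x hx (fun l => ?_) i).trans_eq hi
      rcases eq_or_ne l j with rfl | hlj
      · rw [consensusVec_add_single_apply_self]
        linarith
      · rw [consensusVec_add_single_apply_of_ne _ _ hlj]
        exact hle l
    · exact (hgcons m i).symm.trans_le (hmono _ (subset_closure (hcons m)) _ (subset_closure hmem)
        (le_add_of_nonneg_right (Pi.single_nonneg.2 ht.le)) i)
  obtain ⟨M, hMle, hMex⟩ := exists_max_const_on_limit_orbit (W := id) hg.continuous hgX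
    continuous_id (fun x hx M h j => (hmono x hx _ (subset_closure (hcons M)) h j).trans_eq
      (hgcons M j)) hξ hφ hy
  obtain ⟨m, hmle, hmex⟩ := exists_max_const_on_limit_orbit (W := fun x => -x) hg.continuous hgX
    continuous_neg (fun x hx M h j => neg_le.1 ((hgcons (-M) j).symm.trans_le
      (hmono _ (subset_closure (hcons (-M))) x hx (fun l => neg_le.1 (h l)) j))) hξ hφ hy
  simp only [id, Pi.neg_apply] at hMle hMex hmle hmex
  have hM := forall_eq_max_of_reachable (u := fun k => g^[k] y) hr hMex fun k i h j hij => by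
    rw [Function.iterate_succ_apply'] at h
    exact hup M _ (horb k) (hMle k) i h j (hij.elim (fun e => e ▸ hself i) id)
  have hm := forall_eq_max_of_reachable (u := fun k => -g^[k] y) hr hmex fun k i h j hij => by
    rw [Function.iterate_succ_apply', Pi.neg_apply, neg_eq_iff_eq_neg] at h
    rw [Pi.neg_apply, neg_eq_iff_eq_neg]
    exact hdown (-m) _ (horb k) (fun l => neg_le.1 (hmle k l)) i h j
      (hij.elim (fun e => e ▸ hself i) id)
  have h1 : y r = M := hM 0
  have h2 : -y r = m := hm 0
  refine ⟨M, funext fun j => le_antisymm (hMle 0 j) ?_⟩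
  have h3 : -y j ≤ m := hmle 0 j
  change M ≤ y j
  linarith

end system

theorem mainTheorem6 {n : ℕ} (X : Set (Fin n → ℝ)) (hXopen : IsOpen X) (hXconv : Convex ℝ X)
    (G : Digraph (Fin n)) (f : Fin n → (Fin n → ℝ) → ℝ)
    (hmaps : MapsTo (masMap f) X X)
    (hC1 : ∀ i, ContDiffOn ℝ 1 (f i) X)
    (hlocal : IsLocalRule G X f)
    (hdiag : ∀ i, ∀ x ∈ X, 0 < partialD f i i x)
    (hoff : ∀ i j, j ≠ i → ∀ᵐ x ∂(volume.restrict X), 0 ≤ partialD f i j x)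
    (hplus : ∀ x ∈ X, ∀ α : ℝ, x + consensusVec α ∈ X ∧
      ∀ i, f i (x + consensusVec α) = f i x + α) :
    ((equilibria X f).Nonempty →
      ∀ ξ ∈ X, closure (range (trajectory f ξ)) ⊆ X →
        ∃ xe ∈ equilibria X f, Tendsto (trajectory f ξ) atTop (𝓝 xe)) ∧
    ((0 : Fin n → ℝ) ∈ X → (∀ i, f i 0 = 0) →
      (∃ r, IsGloballyReachable (influenceGraph G X f) r) →
      ∀ ξ ∈ X, ∃ c : ℝ, Tendsto (trajectory f ξ) atTop (𝓝 (consensusVec c))) := by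
  have hnn : ∀ i j, ∀ x ∈ X, 0 ≤ partialD f i j x := fun i j x hx => by
    rcases eq_or_ne j i with rfl | hji
    · exact (hdiag j x hx).le
    · exact partialD_nonneg hXopen (hC1 i) (hoff i j hji) x hx
  have hstrict : ∀ i, ∀ x ∈ X, ∀ y ∈ X, x ≤ y → x i < y i → f i x < f i y :=
    fun i x hx y hy => rule_strictMono_self hXopen hXconv (hC1 i) (hnn i) (hdiag i) hx hy
  obtain ⟨g, hg, hfg, hbound⟩ := exists_extension
    (fun i x hx y hy => rule_mono hXopen hXconv (hC1 i) (hnn i) hx hy) hplus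
  have hgX : MapsTo g X X := fun x hx => hfg hx ▸ hmaps hx
  have htraj : ∀ ξ ∈ X, trajectory f ξ = fun k => g^[k] ξ := fun ξ hξ =>
    funext (trajectory_eq_iterate hmaps hfg hξ)
  constructor
  · rintro ⟨p, hpX, hp⟩ ξ hξ hcl
    have hgp : g p = p := (hfg hpX).symm.trans hp
    obtain ⟨y, φ, hφ, hy⟩ := exists_limit_point hg hgp ξ
    have hyX : y ∈ X := hcl (mem_closure_of_tendsto hy (Eventually.of_forall fun k =>
      ⟨φ k, congrFun (htraj ξ hξ) (φ k)⟩))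
    have hfix : g y = y := by
      rcases isEmpty_or_nonempty (Fin n) with h | h
      · exact Subsingleton.elim _ _
      refine limit_point_isFixed hg hgX
        (fun x hx y hy => hbound x (subset_closure hx) y (subset_closure hy))
        (fun x hx z hz c h i hi => ?_) hgp hξ hyX hφ hy
      have hfx : f i x = g x i := congrFun (hfg hx) i
      have hfz : f i z = g z i := congrFun (hfg hz) i
      rw [← hfx, ← hfz, ← (hplus z hz c).2 i]
      exact hstrict i x hx _ (hplus z hz c).1 h hi
    refine ⟨y, ⟨hyX, (hfg hyX).trans hfix⟩, ?_⟩
    rw [htraj ξ hξ]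
    exact tendsto_iterate_of_subseq hg hφ hy hfix
  · rintro h0 hf0 ⟨r, hr⟩ ξ hξ
    have : Nonempty (Fin n) := ⟨r⟩
    have hcons : ∀ c : ℝ, (consensusVec c : Fin n → ℝ) ∈ X := fun c => by
      simpa using (hplus 0 h0 c).1
    have hfcons : ∀ c : ℝ, ∀ i, f i (consensusVec c) = c := fun c i => by
      simpa [hf0] using (hplus 0 h0 c).2 i
    have hgcons : ∀ c : ℝ, g (consensusVec c) = consensusVec c := fun c =>
      (hfg (hcons c)).symm.trans (funext (hfcons c))
    obtain ⟨y, φ, hφ, hy⟩ := exists_limit_point hg (hgcons 0) ξ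
    have hyX : y ∈ closure X := mem_closure_of_tendsto hy
      (Eventually.of_forall fun k => hgX.iterate (φ k) hξ)
    obtain ⟨c, rfl⟩ := limit_point_isConsensus hXopen hg hfg (hgX.closure hg.continuous) hbound
      hcons hfcons (fun i => influencedBy_self (hstrict i))
      (fun j => Relation.ReflTransGen.mono (fun _ _ h => h.2) _ _ (hr j)) (subset_closure hξ)
      hyX hφ hy
    refine ⟨c, ?_⟩
    rw [htraj ξ hξ]
    exact tendsto_iterate_of_subseq hg hφ hy (hgcons c)
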